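/- Let $V$ be a 5-dimensional real vector space with a Lorentz inner product $g$ of signature $(-++++)$ (for instance the tangent space $T_pM$ at a point $p$ of a 5-dimensional Lorentz manifold), and let $T$ be a real symmetric second order tensor on $V$, regarded also as the linear map $T\colon V\to V$, $v^b\mapsto T^a{}_b v^b$, determined by $g(Tv,w)=T(v,w)$. A vector $v \ne 0$ is timelike, null or spacelike according as $g(v,v)<0$, $=0$ or $>0$. A null direction is a line spanned by a null vector. A subspace is called null if it contains exactly one null direction, and non-null otherwise; a subspace of dimension $\geq 2$ is called spacelike if it contains no null direction (equivalently, $g$ is positive definite on it) and timelike if it contains more than one. Diagonalizable over $\mathbb R$ means that $V$ has a basis of real eigenvectors of $T$; $T$ is of type $\{1,1111\}$ (or a degeneracy thereof) if $T_{ab}=c_0t_at_b+c_1x_ax_b+c_2y_ay_b+c_3z_az_b+c_4w_aw_b$ with real $c_i$, for some basis $t,x,y,z,w$ of $V$ whose only non-vanishing inner products are $-g(t,t)=g(x,x)=g(y,y)=g(z,z)=g(w,w)=1$. Then: \begin{enumerate} \item $T$ has a timelike eigenvector if and only if it is diagonalizable over $\mathbb R$, and this holds if and only if $T$ is of type $\{1,1111\}$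 or a degeneracy thereof. \item $T$ has three linearly independent, mutually orthogonal real eigenvectors, at least two of which are spacelike. \item All (complex) eigenvalues of $T$ are real and $T$ is not diagonalizable over $\mathbb R$ if and only if $T$ has a unique null eigendirection, i.e. there is exactly one line spanned by a null eigenvector of $T$. \item If $T$ has two linearly independent null eigenvectors then it is diagonalizable over $\mathbb R$ (and of type $\{1,1111\}$ or a degeneracy thereof). \item There is a 2-dimensional spacelike subspace of $V$ invariant under $T$. \item If a non-null subspace of $V$ is invariant under $T$, then so is its $g$-orthogonal complement. \item There is a 3-dimensional timelike subspace of $V$ invariant under $T$. \item If $T$ admits a null invariant subspace of some dimension $n\in\{2,3,4\}$, then it admits one of each of the dimensions 2, 3 and 4; this occurs if and only if $T$ admits a null eigenvector; and every null invariant subspace of dimension 2, 3 or 4 contains a null eigenvector of $T$. \end{enumerate} -/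

import Mathlib

namespace Lorentz5

open LinearMap (BilinForm)

section

variable {V : Type*} [AddCommGroup V] [Module ℝ V]

/-- A pseudo-orthonormal pentad `(t, x, y, z, w)`: a basis whose only non-vanishing inner products
are `-g(t,t) = g(x,x) = g(y,y) = g(z,z) = g(w,w) = 1`. -/
def IsPentad (g : BilinForm ℝ V) (b : Module.Basis (Fin 5) ℝ V) : Prop :=
  ∀ i j, g (b i) (b j) = if i = j then (if i = 0 then -1 else 1) else 0

/-- A Lorentz inner product of signature `(- + + + +)`. -/
structure IsLorentz (g : BilinForm ℝ V) : Prop where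
  symm : g.IsSymm
  exists_pentad : ∃ b : Module.Basis (Fin 5) ℝ V, IsPentad g b

theorem IsLorentz.nondegenerate {g : BilinForm ℝ V} (hg : IsLorentz g) : g.Nondegenerate := by
  obtain ⟨b, hb⟩ := hg.exists_pentad
  have ho : g.iIsOrtho b := by
    intro i j hij
    have h := hb i j
    rw [if_neg hij] at h
    exact h
  rw [ho.nondegenerate_iff_not_isOrtho_basis_self]
  intro i hi
  have h := hb i i
  rw [if_pos rfl, show g (b i) (b i) = 0 from hi] at h
  split_ifs at h <;> norm_num at h

/-- The linear transformation `T^a_b` obtained from the tensor `T_{ab}` by raising an index with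
`g`. It is characterized by `g (toEnd hg T v) w = T v w`. -/
noncomputable def toEnd [FiniteDimensional ℝ V] {g : BilinForm ℝ V} (hg : IsLorentz g)
    (T : BilinForm ℝ V) : Module.End ℝ V :=
  BilinForm.symmCompOfNondegenerate T g hg.nondegenerate

theorem apply_toEnd [FiniteDimensional ℝ V] {g : BilinForm ℝ V} (hg : IsLorentz g)
    (T : BilinForm ℝ V) (v w : V) : g (toEnd hg T v) w = T v w :=
  BilinForm.symmCompOfNondegenerate_left_apply T hg.nondegenerate w v

/-- `v` is a real eigenvector of `A` (in particular `v ≠ 0`). -/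
def IsEigenvector (A : Module.End ℝ V) (v : V) : Prop :=
  ∃ μ : ℝ, A.HasEigenvector μ v

def IsTimelikeVec (g : BilinForm ℝ V) (v : V) : Prop := g v v < 0

def IsSpacelikeVec (g : BilinForm ℝ V) (v : V) : Prop := 0 < g v v

def IsNullVec (g : BilinForm ℝ V) (v : V) : Prop := v ≠ 0 ∧ g v v = 0

/-- The null directions contained in a subspace `W`: the lines in `W` spanned by a null vector. -/
def nullDirections (g : BilinForm ℝ V) (W : Submodule ℝ V) : Set (Submodule ℝ V) :=
  {L | ∃ k ∈ W, IsNullVec g k ∧ L = Submodule.span ℝ {k}}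

/-- `W` is spacelike: `g` is positive definite on `W`. When `dim W ≥ 2` this says exactly that `W`
contains no null direction. -/
def IsSpacelikeSubspace (g : BilinForm ℝ V) (W : Submodule ℝ V) : Prop :=
  ∀ v ∈ W, v ≠ 0 → IsSpacelikeVec g v

/-- `W` is null: it contains a unique null direction. -/
def IsNullSubspace (g : BilinForm ℝ V) (W : Submodule ℝ V) : Prop :=
  ∃! L : Submodule ℝ V, L ∈ nullDirections g W

/-- `W` is timelike: it contains more than one null direction. This notion is meant for
`dim W ≥ 2`, where it says exactly that the restriction of `g` to `W` is again Lorentzian. -/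
def IsTimelikeSubspace (g : BilinForm ℝ V) (W : Submodule ℝ V) : Prop :=
  (nullDirections g W).Nontrivial

/-- `A` is diagonalizable over `ℝ`: there is a basis of real eigenvectors. -/
def IsDiagonalizable (A : Module.End ℝ V) : Prop :=
  ∃ b : Module.Basis (Fin 5) ℝ V, ∀ i, IsEigenvector A (b i)

/-- Every complex eigenvalue of `A` (that is, of its complexification) is real. -/
def AllEigenvaluesReal (A : Module.End ℝ V) : Prop :=
  ∀ z : ℂ, Module.End.HasEigenvalue (LinearMap.baseChange ℂ A : Module.End ℂ (TensorProduct ℝ ℂ V)) z →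
    z.im = 0

/-- `T` is of Segre type `{1,1111}` or a degeneracy thereof: in some pseudo-orthonormal pentad it
has the canonical form `T_{ab} = c₀ t_a t_b + c₁ x_a x_b + c₂ y_a y_b + c₃ z_a z_b + c₄ w_a w_b`. -/
def IsType1_1111 (g T : BilinForm ℝ V) : Prop :=
  ∃ b : Module.Basis (Fin 5) ℝ V, IsPentad g b ∧
    ∃ c : Fin 5 → ℝ, ∀ v w, T v w = ∑ i, c i * (g (b i) v * g (b i) w)

/-- The null eigendirections of `A`: the lines spanned by a null eigenvector. -/
def nullEigendirections (g : BilinForm ℝ V) (A : Module.End ℝ V) : Set (Submodule ℝ V) :=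
  {L | ∃ k, IsNullVec g k ∧ IsEigenvector A k ∧ L = Submodule.span ℝ {k}}

/-- `N` is a null subspace of dimension `n` which is invariant under `A`. -/
def IsNullInvariant (g : BilinForm ℝ V) (A : Module.End ℝ V) (n : ℕ) (N : Submodule ℝ V) : Prop :=
  IsNullSubspace g N ∧ Module.finrank ℝ N = n ∧ N ∈ A.invtSubmodule

end

end Lorentz5

namespace Lorentz5

open LinearMap (BilinForm)

/-! ### Spectral theorem on positive definite subspaces. -/

section Spectral

variable {V : Type*} [AddCommGroup V] [Module ℝ V]

/-! Everything rests on a trichotomy for the self-adjoint map `A` attached to `T`: it has a timelike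
eigenvector, a null eigenvector, or a real plane carrying a conjugate pair of eigenvalues
(`exists_timelike_or_null_eigenvector_or_hasRotationPlane`). Otherwise one could split off spacelike
eigenvectors forever, a timelike vector surviving in each orthogonal complement.

Timelike eigenvector `t`: the complement of `t` is invariant and positive definite, so the spectral
theorem gives a pentad of eigenvectors. Rotation plane: the plane contains a timelike vector, so its
complement is invariant, positive definite and of dimension at least 3. It contains every
eigenvector, so none is null. Null eigenvector `k`: `g` is positive definite on `k^⊥/k`, where `A`
induces a symmetric map. Diagonalizing and correcting lifts by multiples of `k` yields two
orthogonal spacelike eigenvectors in `k^⊥` (`exists_spacelike_eigenvector`).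

So two orthogonal spacelike eigenvectors always exist; their span and its complement are the
invariant 2- and 3-spaces. Conversely, a null invariant subspace is orthogonal to its null
direction, which makes that direction an eigendirection. -/

theorem isEigenvector_iff {A : Module.End ℝ V} {v : V} :
    IsEigenvector A v ↔ v ≠ 0 ∧ ∃ μ : ℝ, A v = μ • v := by
  simp only [IsEigenvector, Module.End.hasEigenvector_iff, Module.End.mem_eigenspace_iff]
  tauto

/-- Simultaneous diagonalization of a positive definite and a symmetric bilinear form. -/
theorem exists_basis_orthonormal_diagonal {S : Type*} [AddCommGroup S] [Module ℝ S]
    [FiniteDimensional ℝ S] {n : ℕ} (hn : Module.finrank ℝ S = n) (q h : BilinForm ℝ S)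
    (hq : q.IsSymm) (hpos : ∀ v, v ≠ 0 → 0 < q v v) (hh : h.IsSymm) :
    ∃ b : Module.Basis (Fin n) ℝ S, (∀ i j, q (b i) (b j) = if i = j then 1 else 0) ∧
      ∀ i j, i ≠ j → h (b i) (b j) = 0 := by
  -- `q` becomes the inner product, and the spectral theorem is applied to the operator `B` with `q
  -- (B v) w = h v w`.
  let core : InnerProductSpace.Core ℝ S :=
    { inner := fun v w => q v w
      conj_inner_symm := fun v w => by simpa using hq.eq w v
      re_inner_nonneg := fun v => by
        rcases eq_or_ne v 0 with rfl | hv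
        · simp
        · simpa using (hpos v hv).le
      add_left := fun u v w => by simp
      smul_left := fun u v r => by simp
      definite := fun v hv => by
        by_contra h0
        exact (hpos v h0).ne' hv }
  let _ : NormedAddCommGroup S := core.toNormedAddCommGroup
  let _ : InnerProductSpace ℝ S := InnerProductSpace.ofCore core.toCore
  have hin : ∀ v w : S, inner ℝ v w = q v w := fun v w => rfl
  have hqn : q.Nondegenerate := by
    refine ⟨fun v hv => ?_, fun v hv => ?_⟩ <;>
    · by_contra h0
      exact (hpos v h0).ne' (hv v)
  let B : Module.End ℝ S := BilinForm.symmCompOfNondegenerate h q hqn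
  have hB : ∀ v w, q (B v) w = h v w := fun v w =>
    BilinForm.symmCompOfNondegenerate_left_apply h hqn w v
  have hBs : B.IsSymmetric := fun v w => by
    rw [hin, hin, hB, hq.eq v, hB, hh.eq]
  have hbo := (hBs.eigenvectorBasis hn).orthonormal
  rw [orthonormal_iff_ite] at hbo
  refine ⟨(hBs.eigenvectorBasis hn).toBasis, fun i j => ?_, fun i j hij => ?_⟩
  · simpa [hin] using hbo i j
  · rw [← hB]
    have := hBs.apply_eigenvectorBasis hn i
    simp only [OrthonormalBasis.coe_toBasis, this]
    have h2 := hbo i j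
    rw [hin, if_neg hij] at h2
    simp [h2]

/-- A self-adjoint map on an invariant positive definite subspace has an orthonormal eigenbasis. -/
theorem exists_orthonormal_eigenvectors [FiniteDimensional ℝ V] {n : ℕ} {g : BilinForm ℝ V}
    (hg : g.IsSymm) {A : Module.End ℝ V} (hA : ∀ v w, g (A v) w = g v (A w))
    {S : Submodule ℝ V} (hS : ∀ v ∈ S, A v ∈ S) (hpos : ∀ v ∈ S, v ≠ 0 → 0 < g v v)
    (hn : Module.finrank ℝ S = n) :
    ∃ e : Fin n → V, (∀ i, e i ∈ S) ∧ (∀ i j, g (e i) (e j) = if i = j then 1 else 0) ∧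
      ∀ i, IsEigenvector A (e i) := by
  obtain ⟨b, hb, hd⟩ := exists_basis_orthonormal_diagonal hn (g.restrict S)
    ((g.comp A LinearMap.id).restrict S) ⟨fun v w => hg.eq v w⟩
    (fun v hv => hpos v v.2 (by simpa using hv))
    ⟨fun v w => by simp [hA (v : V) w, hg.eq (v : V) (A w)]⟩
  simp only [BilinForm.restrict_apply, LinearMap.domRestrict_apply, BilinForm.comp_apply,
    LinearMap.id_apply] at hb hd
  refine ⟨fun i => b i, fun i => (b i).2, hb, fun i => isEigenvector_iff.2 ⟨fun h0 => ?_, ?_⟩⟩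
  · have := hb i i
    simp [h0] at this
  · refine ⟨g (A (b i)) (b i), ?_⟩
    -- The residual of `A (b i)` after projection to `b i` is orthogonal to all of `S`, hence zero
    -- by definiteness.
    set u : S := ⟨A (b i), hS _ (b i).2⟩ - g (A (b i)) (b i) • b i with hu
    have h2 : g u ∘ₗ S.subtype = 0 := by
      refine b.ext fun j => ?_
      rcases eq_or_ne i j with rfl | hij
      · simp [hu, hb]
      · simp [hu, hb, hij, hd i j hij]
    have h3 : (u : V) = 0 := by
      by_contra h0
      exact (hpos u u.2 h0).ne' (LinearMap.congr_fun h2 u)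
    simpa [hu, sub_eq_zero] using h3

end Spectral

/-! ### Non-real eigenvalues and real invariant planes. -/

section ComplexEigenvalues

variable {V : Type*} [AddCommGroup V] [Module ℝ V]

/-- `A` has an invariant plane on which it acts with eigenvalues `μ ± iν`, `ν ≠ 0`. -/
def HasRotationPlane (A : Module.End ℝ V) : Prop :=
  ∃ v : V, v ≠ 0 ∧ ∃ μ ν : ℝ, ν ≠ 0 ∧ A (A v) = (2 * μ) • A v - (μ ^ 2 + ν ^ 2) • v

open Polynomial in
theorem aeval_quadratic_apply (A : Module.End ℝ V) (a b : ℝ) (v : V) :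
    aeval A (X ^ 2 - C a * X + C b : ℝ[X]) v = A (A v) - a • A v + b • v := by
  simp [pow_two, Module.algebraMap_end_apply, Module.End.mul_apply]

open Polynomial in
theorem hasRotationPlane_of_aeval {A : Module.End ℝ V} {z : ℂ} (hz : z.im ≠ 0) {v : V}
    (hv : v ≠ 0) (h : aeval A (X ^ 2 - C (2 * z.re) * X + C (‖z‖ ^ 2) : ℝ[X]) v = 0) :
    HasRotationPlane A := by
  refine ⟨v, hv, z.re, z.im, hz, ?_⟩
  rw [aeval_quadratic_apply, Complex.sq_norm, Complex.normSq_apply] at h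
  have : A (A v) - ((2 * z.re) • A v - (z.re * z.re + z.im * z.im) • v) = 0 := by
    rw [← h]; abel
  rw [sub_eq_zero.1 this, pow_two, pow_two]

open Polynomial in
/-- A real endomorphism of a nonzero finite-dimensional space has a real eigenvector or a plane
on which it acts with a pair of conjugate eigenvalues. -/
theorem exists_isEigenvector_or_hasRotationPlane [FiniteDimensional ℝ V] [Nontrivial V]
    (A : Module.End ℝ V) : (∃ v, IsEigenvector A v) ∨ HasRotationPlane A := by
  have hint : IsIntegral ℝ A := Algebra.IsIntegral.isIntegral A
  obtain ⟨z, hz⟩ := IsAlgClosed.exists_aeval_eq_zero ℂ (minpoly ℝ A)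
    (minpoly.degree_pos hint).ne'
  by_cases him : z.im = 0
  · left
    have hroot : (minpoly ℝ A).IsRoot z.re := by
      have h1 : z = algebraMap ℝ ℂ z.re := by
        apply Complex.ext <;> simp [him]
      rw [h1, aeval_algebraMap_apply] at hz
      simpa [IsRoot, aeval_def] using hz
    obtain ⟨v, hv⟩ := (Module.End.hasEigenvalue_of_isRoot hroot).exists_hasEigenvector
    exact ⟨v, _, hv⟩
  · right
    obtain ⟨r, hr⟩ := quadratic_dvd_of_aeval_eq_zero_im_ne_zero _ hz him
    set q : ℝ[X] := X ^ 2 - C (2 * z.re) * X + C (‖z‖ ^ 2) with hq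
    have hm : minpoly ℝ A ≠ 0 := minpoly.ne_zero hint
    have hr0 : r ≠ 0 := fun h => hm (by rw [hr, h, mul_zero])
    have hqd : q.natDegree = 2 := by rw [hq]; compute_degree!
    have hq0 : q ≠ 0 := fun h => by simp [h] at hqd
    -- The cofactor `r` has degree below that of the minimal polynomial, so `r(A) ≠ 0`; the
    -- quadratic factor kills every vector in its range.
    have hra : aeval A r ≠ 0 := fun h => by
      have h1 := natDegree_le_of_dvd (minpoly.dvd ℝ A h) hr0
      rw [hr, natDegree_mul hq0 hr0, hqd] at h1
      omega
    obtain ⟨w, hw⟩ : ∃ w, aeval A r w ≠ 0 := by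
      by_contra! h
      exact hra (LinearMap.ext h)
    refine hasRotationPlane_of_aeval him hw ?_
    rw [← Module.End.mul_apply, ← map_mul, ← hq, ← hr, minpoly.aeval]
    rfl

-- If the real quadratic with root `z` were injective at `A`, it would be invertible and stay so
-- after complexification, where it kills an eigenvector for `z`.
open Polynomial in
theorem hasRotationPlane_of_not_allEigenvaluesReal [FiniteDimensional ℝ V] {A : Module.End ℝ V}
    (h : ¬ AllEigenvaluesReal A) : HasRotationPlane A := by
  simp only [AllEigenvaluesReal, not_forall] at h
  obtain ⟨z, hz, him⟩ := h
  by_contra hno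
  set q : ℝ[X] := X ^ 2 - C (2 * z.re) * X + C (‖z‖ ^ 2) with hq
  have hinj : Function.Injective (aeval A q) := by
    rw [injective_iff_map_eq_zero]
    intro v hv
    by_contra hv0
    exact hno (hasRotationPlane_of_aeval him hv0 hv)
  have hunit : IsUnit (aeval A q) := by
    rw [Module.End.isUnit_iff]
    exact ⟨hinj, LinearMap.injective_iff_surjective.1 hinj⟩
  have hunit' := hunit.map (Module.End.baseChangeHom ℝ ℂ V)
  rw [← aeval_algHom_apply] at hunit'
  obtain ⟨w, hw⟩ := hz.exists_hasEigenvector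
  have hw1 : Module.End.baseChangeHom ℝ ℂ V A w = z • w := hw.apply_eq_smul
  have hqw : aeval (Module.End.baseChangeHom ℝ ℂ V A) q w = 0 := by
    have h1 : aeval (Module.End.baseChangeHom ℝ ℂ V A) q w = (aeval z q) • w := by
      simp only [hq, map_add, map_sub, map_mul, aeval_X, aeval_C, LinearMap.add_apply,
        LinearMap.sub_apply, Module.End.mul_apply, pow_two, hw1, map_smul,
        Module.algebraMap_end_apply, add_smul, sub_smul, mul_smul, algebraMap_smul]
      rw [smul_comm z (2 : ℝ), smul_comm z z.re]
    rw [h1]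
    have h2 : aeval z q = 0 := by
      simp only [hq, map_add, map_sub, map_mul, map_pow, aeval_X, aeval_C, Complex.sq_norm,
        Complex.normSq_apply]
      apply Complex.ext <;> simp [pow_two] <;> ring
    rw [h2, zero_smul]
  exact hw.2 (((Module.End.isUnit_iff _).1 hunit').1 (hqw.trans (map_zero _).symm))

/-- Over `ℂ` the quadratic splits into two conjugate linear factors: either one of them kills `1 ⊗
v`, or its value there is an eigenvector for the other root. -/
theorem not_hasRotationPlane_of_allEigenvaluesReal {A : Module.End ℝ V}
    (h : AllEigenvaluesReal A) : ¬ HasRotationPlane A := by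
  rintro ⟨v, hv, μ, ν, hν, hAv⟩
  let B : Module.End ℂ (TensorProduct ℝ ℂ V) := LinearMap.baseChange ℂ A
  let x : TensorProduct ℝ ℂ V := 1 ⊗ₜ[ℝ] v
  have hx : x ≠ 0 := fun h0 => hv
    ((Module.FaithfullyFlat.one_tmul_eq_zero_iff ℝ V v).1 h0)
  have hBx : B (B x) = (2 * μ : ℂ) • B x - (μ ^ 2 + ν ^ 2 : ℂ) • x := by
    simp only [B, x, LinearMap.baseChange_tmul, hAv, TensorProduct.tmul_sub,
      TensorProduct.tmul_smul]
    simp [TensorProduct.smul_tmul']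
  have key : ∀ (z : ℂ) (y : TensorProduct ℝ ℂ V), y ≠ 0 → B y = z • y → z.im = 0 :=
    fun z y hy h1 => h z (Module.End.hasEigenvalue_of_hasEigenvector
      ⟨Module.End.mem_eigenspace_iff.2 h1, hy⟩)
  by_cases hy : B x - (μ - ν * Complex.I) • x = 0
  · have := key _ x hx (sub_eq_zero.1 hy)
    simp [hν] at this
  · have := key (μ + ν * Complex.I) _ hy (by
      rw [map_sub, map_smul, hBx]
      have hI : (μ + ν * Complex.I) * (μ - ν * Complex.I) = (μ ^ 2 + ν ^ 2 : ℂ) := by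
        ring_nf; simp
      rw [smul_sub, smul_smul, hI]
      module)
    simp [hν] at this

end ComplexEigenvalues

/-! ### Dimension and invariance of hyperplane sections. -/

section Subspaces

variable {V : Type*} [AddCommGroup V] [Module ℝ V]

theorem finrank_inf_ker_add_one [FiniteDimensional ℝ V] {U : Submodule ℝ V} {f : V →ₗ[ℝ] ℝ}
    {u : V} (hu : u ∈ U) (hfu : f u ≠ 0) :
    Module.finrank ℝ (U ⊓ LinearMap.ker f : Submodule ℝ V) + 1 = Module.finrank ℝ U := by
  have h1 : f ∘ₗ U.subtype ≠ 0 := fun h => hfu (LinearMap.congr_fun h ⟨u, hu⟩)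
  rw [← Module.Dual.finrank_ker_add_one_of_ne_zero h1, ← Submodule.finrank_map_subtype_eq,
    LinearMap.ker_comp, Submodule.map_comap_subtype]

theorem finrank_le_finrank_inf_ker_add_one [FiniteDimensional ℝ V] (U : Submodule ℝ V)
    (f : V →ₗ[ℝ] ℝ) :
    Module.finrank ℝ U ≤ Module.finrank ℝ (U ⊓ LinearMap.ker f : Submodule ℝ V) + 1 := by
  by_cases h : ∃ u ∈ U, f u ≠ 0
  · obtain ⟨u, hu, hfu⟩ := h
    exact (finrank_inf_ker_add_one hu hfu).ge
  · push Not at h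
    rw [inf_eq_left.2 fun u hu => h u hu]
    exact Nat.le_succ _

theorem exists_ne_zero_mem_inf_ker [FiniteDimensional ℝ V] {U : Submodule ℝ V} (f : V →ₗ[ℝ] ℝ)
    (hU : 2 ≤ Module.finrank ℝ U) : ∃ u ∈ U, f u = 0 ∧ u ≠ 0 := by
  have h1 := finrank_le_finrank_inf_ker_add_one U f
  have h2 : U ⊓ LinearMap.ker f ≠ ⊥ := fun h => by
    rw [h, finrank_bot] at h1
    omega
  obtain ⟨u, hu, hu0⟩ := Submodule.exists_mem_ne_zero_of_ne_bot h2
  exact ⟨u, hu.1, hu.2, hu0⟩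

theorem inf_ker_invariant {g : BilinForm ℝ V} {A : Module.End ℝ V}
    (hA : ∀ v w, g (A v) w = g v (A w)) {U : Submodule ℝ V} (hU : ∀ v ∈ U, A v ∈ U) {x : V}
    {μ : ℝ} (hx : A x = μ • x) :
    ∀ v ∈ U ⊓ LinearMap.ker (g x), A v ∈ U ⊓ LinearMap.ker (g x) := by
  rintro v ⟨hv, hxv⟩
  refine ⟨hU v hv, ?_⟩
  rw [SetLike.mem_coe, LinearMap.mem_ker] at hxv ⊢
  rw [← hA, hx, map_smul, LinearMap.smul_apply, hxv, smul_zero]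

end Subspaces

/-! ### Causal geometry of Lorentz space. -/

section Causal

variable {V : Type*} [AddCommGroup V] [Module ℝ V] {g : BilinForm ℝ V}

theorem IsLorentz.finrank_eq (hg : IsLorentz g) : Module.finrank ℝ V = 5 := by
  obtain ⟨b, -⟩ := hg.exists_pentad
  simpa using Module.finrank_eq_card_basis b

theorem IsPentad.apply_self {b : Module.Basis (Fin 5) ℝ V} (hb : IsPentad g b) (v : V) :
    g v v = -(b.repr v 0) ^ 2 + ((b.repr v 1) ^ 2 + (b.repr v 2) ^ 2 + (b.repr v 3) ^ 2
      + (b.repr v 4) ^ 2) := by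
  conv_lhs => rw [← b.sum_repr v]
  simp [-Module.Basis.sum_repr, Fin.sum_univ_five, hb _ _]
  ring

theorem IsPentad.apply_zero {b : Module.Basis (Fin 5) ℝ V} (hb : IsPentad g b) :
    g (b 0) (b 0) = -1 := by simp [hb _ _]

/-- Any vector is, modulo a given non-spacelike vector, zero or spacelike. -/
theorem IsLorentz.exists_sub_smul (hg : IsLorentz g) {t : V} (ht : t ≠ 0) (htt : g t t ≤ 0)
    (v : V) : ∃ α : ℝ, v = α • t ∨ 0 < g (v - α • t) (v - α • t) := by
  obtain ⟨b, hb⟩ := hg.exists_pentad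
  have hzero : ∀ u, b.repr u 0 = 0 → g u u ≤ 0 → u = 0 := by
    intro u h0 h1
    rw [hb.apply_self, h0] at h1
    have e1 := sq_nonneg (b.repr u 1)
    have e2 := sq_nonneg (b.repr u 2)
    have e3 := sq_nonneg (b.repr u 3)
    have e4 := sq_nonneg (b.repr u 4)
    refine b.ext_elem fun i => ?_
    rw [map_zero, Finsupp.zero_apply]
    fin_cases i
    · exact h0
    all_goals exact pow_eq_zero_iff two_ne_zero |>.1 (by simp only [Fin.reduceFinMk]; linarith)
  have ht0 : b.repr t 0 ≠ 0 := fun h => ht (hzero t h htt)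
  -- This `α` cancels the time component of `v`; by `hzero`, what remains is zero or spacelike.
  refine ⟨b.repr v 0 / b.repr t 0, ?_⟩
  by_contra! h
  refine h.1 (sub_eq_zero.1 (hzero _ ?_ h.2))
  simp [ht0]

theorem IsLorentz.pos_of_orthogonal_timelike (hg : IsLorentz g) {t : V} (ht : g t t < 0) {v : V}
    (hv : v ≠ 0) (htv : g t v = 0) : 0 < g v v := by
  have ht0 : t ≠ 0 := by rintro rfl; simp at ht
  obtain ⟨α, rfl | h⟩ := hg.exists_sub_smul ht0 ht.le v
  · have : α = 0 := by simpa [ht.ne] using htv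
    simp [this] at hv
  · have hvt : g v t = 0 := by rw [hg.symm.eq, htv]
    simp only [map_sub, map_smul, LinearMap.sub_apply, LinearMap.smul_apply, htv, hvt,
      smul_eq_mul] at h
    nlinarith [sq_nonneg α]

/-- Subtracting a multiple of `k` from a vector orthogonal to `k` does not change its square. -/
theorem IsLorentz.pos_of_orthogonal_null (hg : IsLorentz g) {k : V} (hk : IsNullVec g k) {v : V}
    (hkv : g k v = 0) : (∃ α : ℝ, v = α • k) ∨ 0 < g v v := by
  obtain ⟨α, h | h⟩ := hg.exists_sub_smul hk.1 hk.2.le v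
  · exact Or.inl ⟨α, h⟩
  · have hvk : g v k = 0 := by rw [hg.symm.eq, hkv]
    right
    simpa [hkv, hvk, hk.2] using h

theorem IsLorentz.exists_apply_ne_zero (hg : IsLorentz g) {v : V} (hv : v ≠ 0) :
    ∃ w, g v w ≠ 0 := by
  by_contra! h
  exact hv (hg.nondegenerate.1 v h)

theorem IsLorentz.finrank_ker (hg : IsLorentz g) [FiniteDimensional ℝ V] {v : V} (hv : v ≠ 0) :
    Module.finrank ℝ (LinearMap.ker (g v)) = 4 := by
  obtain ⟨w, hw⟩ := hg.exists_apply_ne_zero hv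
  have := finrank_inf_ker_add_one (Submodule.mem_top (x := w)) hw
  rw [top_inf_eq, finrank_top, hg.finrank_eq] at this
  omega

theorem isNullSubspace_of_le_ker (hg : IsLorentz g) {k : V} (hk : IsNullVec g k)
    {N : Submodule ℝ V} (hkN : k ∈ N) (hN : N ≤ LinearMap.ker (g k)) : IsNullSubspace g N := by
  refine ⟨Submodule.span ℝ {k}, ⟨k, hkN, hk, rfl⟩, ?_⟩
  rintro _ ⟨l, hl, hln, rfl⟩
  obtain ⟨α, rfl⟩ | h := hg.pos_of_orthogonal_null hk (hN hl)
  · have hα : α ≠ 0 := by rintro rfl; simp [IsNullVec] at hln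
    exact Submodule.span_singleton_smul_eq (IsUnit.mk0 α hα) k
  · exact absurd hln.2 h.ne'

/-- The null direction of a null subspace is orthogonal to the whole subspace. -/
theorem IsNullSubspace.exists_null (hg : IsLorentz g) {N : Submodule ℝ V}
    (hN : IsNullSubspace g N) : ∃ k ∈ N, IsNullVec g k ∧ ∀ v ∈ N, g k v = 0 := by
  obtain ⟨L, ⟨k, hkN, hk, rfl⟩, huniq⟩ := hN
  refine ⟨k, hkN, hk, fun v hv => ?_⟩
  by_contra hkv
  have hvk : g v k = g k v := hg.symm.eq v k
  -- `l` spans the second null direction of the plane of `k` and `v`: the coefficient solves `g l l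
  -- = 0`.
  set l := v - (g v v / (2 * g k v)) • k with hl
  have hkl : g k l = g k v := by simp [hl, hk.2]
  have hl0 : l ≠ 0 := by
    intro h
    rw [h, map_zero] at hkl
    exact hkv hkl.symm
  have hll : g l l = 0 := by
    simp only [hl, map_sub, map_smul, LinearMap.sub_apply, LinearMap.smul_apply, hk.2, hvk,
      smul_eq_mul]
    field_simp
    ring
  have h1 := huniq _ ⟨l, N.sub_mem hv (N.smul_mem _ hkN), ⟨hl0, hll⟩, rfl⟩
  have h2 : l ∈ Submodule.span ℝ {k} := h1 ▸ Submodule.mem_span_singleton_self l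
  obtain ⟨a, ha⟩ := Submodule.mem_span_singleton.1 h2
  rw [← ha, map_smul, hk.2, smul_zero] at hkl
  exact hkv hkl.symm

theorem isTimelikeSubspace_of_mem [FiniteDimensional ℝ V] (hg : IsLorentz g) {W : Submodule ℝ V}
    (hW : 2 ≤ Module.finrank ℝ W) {t : V} (ht : t ∈ W) (htt : g t t < 0) :
    IsTimelikeSubspace g W := by
  obtain ⟨s, hs, hts, hs0⟩ := exists_ne_zero_mem_inf_ker (g t) hW
  have hss := hg.pos_of_orthogonal_timelike htt hs0 hts
  have hst : g s t = 0 := by rw [hg.symm.eq, hts]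
  -- Scaled so that `r • s` and `t` have opposite squares; then `r • s ± t` are two independent null
  -- vectors.
  set r := Real.sqrt (-g t t / g s s)
  have hr : r ^ 2 * g s s = -g t t := by
    rw [Real.sq_sqrt (div_nonneg (by linarith) hss.le)]
    field_simp
  have hr0 : r ≠ 0 := by
    intro h
    rw [h] at hr
    linarith
  have hnull : ∀ ε : ℝ, ε ^ 2 = 1 → IsNullVec g (r • s + ε • t) := by
    intro ε hε
    constructor
    · intro h
      have h1 : g s (r • s + ε • t) = 0 := by rw [h, map_zero]
      simp [hst, hr0, hss.ne'] at h1
    · simp only [map_add, map_smul, LinearMap.add_apply, LinearMap.smul_apply, hst, hts,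
        smul_eq_mul]
      linear_combination hr + g t t * hε
  have hmem : ∀ ε : ℝ, r • s + ε • t ∈ W := fun ε =>
    W.add_mem (W.smul_mem _ hs) (W.smul_mem _ ht)
  refine ⟨_, ⟨_, hmem 1, hnull 1 (by norm_num), rfl⟩, _, ⟨_, hmem (-1), hnull (-1) (by norm_num),
    rfl⟩, fun h => ?_⟩
  have h1 : r • s + (1 : ℝ) • t ∈ Submodule.span ℝ {r • s + (-1 : ℝ) • t} :=
    h ▸ Submodule.mem_span_singleton_self _
  obtain ⟨a, ha⟩ := Submodule.mem_span_singleton.1 h1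
  have hs1 := congrArg (g s) ha
  have ht1 := congrArg (g t) ha
  simp only [map_add, map_smul, hst, hts, smul_eq_mul] at hs1 ht1
  have e1 : (a - 1) * (r * g s s) = 0 := by linear_combination hs1
  have e2 : (a + 1) * g t t = 0 := by linear_combination -ht1
  have e3 := (mul_eq_zero.1 e1).resolve_right (mul_ne_zero hr0 hss.ne')
  have e4 := (mul_eq_zero.1 e2).resolve_right htt.ne
  linarith

end Causal

/-! ### Eigenvectors of self-adjoint maps. -/

section SelfAdjoint

variable {V : Type*} [AddCommGroup V] [Module ℝ V] {g : BilinForm ℝ V} {A : Module.End ℝ V}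

theorem isEigenvector_of_apply_self_ne_zero {x : V} {μ : ℝ} (hx : g x x ≠ 0) (h : A x = μ • x) :
    IsEigenvector A x :=
  isEigenvector_iff.2 ⟨by rintro rfl; simp at hx, μ, h⟩

/-- A self-adjoint map with a timelike eigenvector has a pentad of eigenvectors. -/
theorem exists_pentad_of_timelike_eigenvector (hg : IsLorentz g) [FiniteDimensional ℝ V]
    (hA : ∀ v w, g (A v) w = g v (A w)) {t : V} (htt : g t t < 0) (ht : IsEigenvector A t) :
    ∃ b : Module.Basis (Fin 5) ℝ V, IsPentad g b ∧ ∀ i, IsEigenvector A (b i) := by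
  obtain ⟨ht0, μ, hμ⟩ := isEigenvector_iff.1 ht
  have hinv := inf_ker_invariant hA (U := ⊤) (fun _ _ => trivial) hμ
  rw [top_inf_eq] at hinv
  obtain ⟨e, heS, heo, hev⟩ := exists_orthonormal_eigenvectors hg.symm hA hinv
    (fun v hv hv0 => hg.pos_of_orthogonal_timelike htt hv0 hv) (hg.finrank_ker ht0)
  set r := (Real.sqrt (-g t t))⁻¹ with hr
  have hr0 : r ≠ 0 := inv_ne_zero (Real.sqrt_pos.2 (by linarith)).ne'
  have hrr : r * r * g t t = -1 := by
    rw [hr, ← mul_inv, Real.mul_self_sqrt (by linarith)]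
    field_simp [htt.ne]
  let c : Fin 5 → V := Fin.cons (r • t) e
  have hte : ∀ i, g t (e i) = 0 := heS
  have het : ∀ i, g (e i) t = 0 := fun i => by rw [hg.symm.eq, hte]
  have hc : ∀ i j, g (c i) (c j) = if i = j then (if i = 0 then -1 else 1) else 0 := by
    intro i j
    refine Fin.cases ?_ (fun i => ?_) i <;> refine Fin.cases ?_ (fun j => ?_) j
    · simp [c, ← mul_assoc, hrr]
    · simp [c, hte, (Fin.succ_ne_zero j).symm]
    · simp [c, het]
    · simp [c, heo]
  have hli : LinearIndependent ℝ c := by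
    refine BilinForm.linearIndependent_of_iIsOrtho (B := g) ?_ ?_
    · intro i j hij
      change g (c i) (c j) = 0
      rw [hc, if_neg hij]
    · intro i h
      change g (c i) (c i) = 0 at h
      rw [hc, if_pos rfl] at h
      split_ifs at h <;> norm_num at h
  refine ⟨basisOfLinearIndependentOfCardEqFinrank hli (by simp [hg.finrank_eq]), ?_, ?_⟩
  · intro i j
    simpa using hc i j
  · intro i
    rw [coe_basisOfLinearIndependentOfCardEqFinrank]
    refine Fin.cases ?_ (fun i => ?_) i
    · refine isEigenvector_iff.2 ⟨smul_ne_zero hr0 ht0, μ, ?_⟩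
      simp [c, hμ, smul_comm r μ]
    · exact hev i

/-- A self-adjoint map with a basis of eigenvectors has a timelike eigenvector. -/
theorem exists_timelike_eigenvector_of_isDiagonalizable (hg : IsLorentz g)
    (hA : ∀ v w, g (A v) w = g v (A w)) (hd : IsDiagonalizable A) :
    ∃ v, IsTimelikeVec g v ∧ IsEigenvector A v := by
  classical
  obtain ⟨b, hb⟩ := hg.exists_pentad
  obtain ⟨e, he⟩ := hd
  -- The eigencomponents of the timelike `b 0` are mutually orthogonal, so their squares add up to
  -- `-1` and one of them is timelike.
  have htop : b 0 ∈ ⨆ μ : ℝ, A.eigenspace μ := by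
    rw [← e.sum_repr (b 0)]
    refine Submodule.sum_mem _ fun i _ => Submodule.smul_mem _ _ ?_
    obtain ⟨μ, hμ⟩ := he i
    exact Submodule.mem_iSup_of_mem μ hμ.1
  obtain ⟨f, hf, hsum⟩ := (Submodule.mem_iSup_iff_exists_finsupp _ _).1 htop
  have hortho : ∀ μ ν, μ ≠ ν → g (f μ) (f ν) = 0 := by
    intro μ ν hμν
    have h1 := hA (f μ) (f ν)
    rw [Module.End.mem_eigenspace_iff.1 (hf μ), Module.End.mem_eigenspace_iff.1 (hf ν)] at h1
    simp only [map_smul, LinearMap.smul_apply, smul_eq_mul] at h1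
    have h2 : (μ - ν) * g (f μ) (f ν) = 0 := by linear_combination h1
    exact (mul_eq_zero.1 h2).resolve_left (sub_ne_zero.2 hμν)
  have hneg : ∑ μ ∈ f.support, g (f μ) (f μ) < 0 := by
    have h1 : g (b 0) (b 0) = ∑ μ ∈ f.support, g (f μ) (f μ) := by
      rw [← hsum, Finsupp.sum, map_sum]
      refine Finset.sum_congr rfl fun μ hμ => ?_
      rw [map_sum, LinearMap.sum_apply, Finset.sum_eq_single μ (fun ν _ h => hortho ν μ h)
        (fun h => absurd hμ h)]
    rw [← h1, hb.apply_zero]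
    norm_num
  obtain ⟨μ, -, hμ⟩ := Finset.exists_lt_of_sum_lt (s := f.support) (g := fun _ => (0 : ℝ))
    (f := fun μ => g (f μ) (f μ)) (by simpa using hneg)
  exact ⟨f μ, hμ, isEigenvector_of_apply_self_ne_zero (ne_of_lt hμ)
    (Module.End.mem_eigenspace_iff.1 (hf μ))⟩

/-- Two independent null eigenvectors force a timelike eigenvector. -/
theorem exists_timelike_eigenvector_of_null_null (hg : IsLorentz g)
    (hA : ∀ v w, g (A v) w = g v (A w)) {k l : V} (hk : IsNullVec g k) (hl : IsNullVec g l)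
    (hkl : ∀ α : ℝ, l ≠ α • k) (hke : IsEigenvector A k) (hle : IsEigenvector A l) :
    ∃ v, IsTimelikeVec g v ∧ IsEigenvector A v := by
  obtain ⟨-, μ, hμ⟩ := isEigenvector_iff.1 hke
  obtain ⟨-, ν, hν⟩ := isEigenvector_iff.1 hle
  have hne : g k l ≠ 0 := by
    intro h
    obtain ⟨α, hα⟩ | h := hg.pos_of_orthogonal_null hk h
    · exact hkl α hα
    · exact h.ne' hl.2
  have h1 := hA k l
  rw [hμ, hν] at h1
  simp only [map_smul, LinearMap.smul_apply, smul_eq_mul] at h1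
  -- The eigenvalues agree, so `A` is scalar on the plane of `k` and `l`; the vector `l - g k l • k`
  -- in it has square `-2 (g k l)²`.
  obtain rfl := mul_right_cancel₀ hne h1
  have hlt : g (l - g k l • k) (l - g k l • k) < 0 := by
    simp only [map_sub, map_smul, LinearMap.sub_apply, LinearMap.smul_apply, smul_eq_mul, hk.2,
      hl.2, hg.symm.eq l k]
    nlinarith [mul_self_pos.2 hne]
  refine ⟨_, hlt, isEigenvector_of_apply_self_ne_zero hlt.ne (μ := μ) ?_⟩
  rw [map_sub, map_smul, hμ, hν]
  module

/-- With a timelike eigenvector, there is no or more than one null eigendirection. -/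
theorem not_existsUnique_nullEigendirection (hg : IsLorentz g)
    (hA : ∀ v w, g (A v) w = g v (A w)) {t : V} (htt : g t t < 0) (ht : IsEigenvector A t) :
    ¬ ∃! L : Submodule ℝ V, L ∈ nullEigendirections g A := by
  rintro ⟨L, ⟨k, hk, hke, rfl⟩, huniq⟩
  obtain ⟨-, μ, hμ⟩ := isEigenvector_iff.1 ht
  obtain ⟨-, ν, hν⟩ := isEigenvector_iff.1 hke
  have hne : g t k ≠ 0 := fun h => (hg.pos_of_orthogonal_timelike htt hk.1 h).ne' hk.2
  have h1 := hA t k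
  rw [hμ, hν] at h1
  simp only [map_smul, LinearMap.smul_apply, smul_eq_mul] at h1
  obtain rfl := mul_right_cancel₀ hne h1
  have hkt : g k t = g t k := hg.symm.eq k t
  -- `k - c • t` is the reflection of `k` in `t^⊥`: again null, and in the same eigenspace.
  set c := 2 * g t k / g t t with hc
  have hct : c * g t t = 2 * g t k := by rw [hc]; field_simp [htt.ne]
  have hc0 : c ≠ 0 := by
    intro h
    rw [h, zero_mul] at hct
    exact hne (by linarith)
  have hl : IsNullVec g (k - c • t) := by
    constructor
    · intro h
      have h2 := congrArg (g t) h
      simp only [map_sub, map_smul, smul_eq_mul, map_zero] at h2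
      exact hne (by linarith)
    · simp only [map_sub, map_smul, LinearMap.sub_apply, LinearMap.smul_apply, smul_eq_mul, hk.2,
        hkt]
      linear_combination c * hct
  have h2 := huniq _ ⟨_, hl, isEigenvector_iff.2 ⟨hl.1, μ, by
    rw [map_sub, map_smul, hμ, hν]; module⟩, rfl⟩
  have h3 : k - c • t ∈ Submodule.span ℝ {k} := h2 ▸ Submodule.mem_span_singleton_self _
  obtain ⟨a, ha⟩ := Submodule.mem_span_singleton.1 h3
  have h4 := congrArg (g k) ha
  simp only [map_sub, map_smul, smul_eq_mul, hk.2, hkt, mul_zero, zero_sub] at h4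
  exact mul_ne_zero hc0 hne (by linarith)

/-- A self-adjoint map with a rotation plane leaves invariant a positive definite subspace of
codimension at most two that contains every eigenvector. -/
theorem HasRotationPlane.exists_invariant (hg : IsLorentz g) [FiniteDimensional ℝ V]
    (hA : ∀ v w, g (A v) w = g v (A w)) (h : HasRotationPlane A) :
    ∃ S : Submodule ℝ V, 3 ≤ Module.finrank ℝ S ∧ (∀ v ∈ S, A v ∈ S) ∧
      (∀ v ∈ S, v ≠ 0 → 0 < g v v) ∧ ∀ v, IsEigenvector A v → v ∈ S := by
  obtain ⟨v, hv0, μ, ν, hν, hv⟩ := h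
  have hν2 : 0 < ν ^ 2 := by positivity
  set w := A v - μ • v with hw
  have hAv : A v = μ • v + w := by rw [hw]; abel
  have hAw : A w = μ • w - ν ^ 2 • v := by
    rw [hw, map_sub, map_smul, hv]
    module
  have hwv : g w v = g v w := hg.symm.eq w v
  have hww : g w w = -ν ^ 2 * g v v := by
    have h1 := hA v w
    rw [hAv, hAw] at h1
    simp only [map_add, map_sub, map_smul, LinearMap.add_apply, LinearMap.smul_apply,
      smul_eq_mul] at h1
    linear_combination h1
  -- Since `g w w = -ν² g v v`, one of `v`, `w` is timelike unless both are null. In that case `g v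
  -- w ≠ 0`, as otherwise `w = α • v` would give `α² + ν² = 0`.
  obtain ⟨x, y, hxy⟩ : ∃ x y : ℝ, g (x • v + y • w) (x • v + y • w) < 0 := by
    rcases lt_trichotomy (g v v) 0 with h | h | h
    · exact ⟨1, 0, by simpa using h⟩
    · have hne : g v w ≠ 0 := by
        intro hvw
        obtain ⟨α, hα⟩ | h' := hg.pos_of_orthogonal_null ⟨hv0, h⟩ hvw
        · have h1 : (α ^ 2 + ν ^ 2) • v = 0 := by
            have h2 := hAw
            rw [hα, map_smul, hAv, hα] at h2
            rw [← sub_eq_zero] at h2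
            rw [← h2]
            module
          exact hv0 ((smul_eq_zero.1 h1).resolve_left (by positivity))
        · rw [hww, h, mul_zero] at h'
          exact h'.false
      refine ⟨1, -g v w, ?_⟩
      simp only [map_add, map_smul, LinearMap.add_apply, LinearMap.smul_apply, smul_eq_mul, h, hww,
        hwv]
      nlinarith [mul_self_pos.2 hne]
    · exact ⟨0, 1, by simp [hww]; positivity⟩
  refine ⟨LinearMap.ker (g v) ⊓ LinearMap.ker (g w), ?_, ?_, ?_, ?_⟩
  · have h1 := finrank_le_finrank_inf_ker_add_one (LinearMap.ker (g v)) (g w)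
    rw [hg.finrank_ker hv0] at h1
    omega
  · rintro u ⟨hvu, hwu⟩
    rw [SetLike.mem_coe, LinearMap.mem_ker] at hvu hwu
    constructor
    · rw [SetLike.mem_coe, LinearMap.mem_ker, ← hA, hAv]
      simp [hvu, hwu]
    · rw [SetLike.mem_coe, LinearMap.mem_ker, ← hA, hAw]
      simp [hvu, hwu]
  · rintro u ⟨hvu, hwu⟩ hu0
    rw [SetLike.mem_coe, LinearMap.mem_ker] at hvu hwu
    exact hg.pos_of_orthogonal_timelike hxy hu0 (by simp [hvu, hwu])
  · intro k hk
    obtain ⟨-, l, hl⟩ := isEigenvector_iff.1 hk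
    have h1 := hA v k
    have h2 := hA w k
    rw [hAv, hl] at h1
    rw [hAw, hl] at h2
    simp only [map_add, map_sub, map_smul, LinearMap.add_apply, LinearMap.sub_apply,
      LinearMap.smul_apply, smul_eq_mul] at h1 h2
    -- Eliminating `g w k` leaves the quadratic of the plane evaluated at the real eigenvalue `l`,
    -- where it is positive.
    have h3 : ((l - μ) ^ 2 + ν ^ 2) * g v k = 0 := by
      linear_combination (μ - l) * h1 - h2
    have h4 : g v k = 0 := (mul_eq_zero.1 h3).resolve_left (by positivity)
    refine ⟨h4, ?_⟩
    rw [SetLike.mem_coe, LinearMap.mem_ker]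
    rw [h4] at h1
    linarith

theorem HasRotationPlane.not_null_eigenvector (hg : IsLorentz g) [FiniteDimensional ℝ V]
    (hA : ∀ v w, g (A v) w = g v (A w)) (h : HasRotationPlane A) {k : V} (hk : IsNullVec g k) :
    ¬ IsEigenvector A k := fun hke => by
  obtain ⟨S, -, -, hpos, hS⟩ := h.exists_invariant hg hA
  exact (hpos k (hS k hke) hk.1).ne' hk.2

/-- A self-adjoint map has a timelike eigenvector, a null eigenvector or a rotation plane. -/
theorem exists_timelike_or_null_eigenvector_or_hasRotationPlane (hg : IsLorentz g)
    [FiniteDimensional ℝ V] (hA : ∀ v w, g (A v) w = g v (A w)) :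
    (∃ v, IsTimelikeVec g v ∧ IsEigenvector A v) ∨ (∃ k, IsNullVec g k ∧ IsEigenvector A k) ∨
      HasRotationPlane A := by
  by_contra! hno
  obtain ⟨hno1, hno2, hno3⟩ := hno
  -- Induction on dimension: `U` has an eigenvector `x`, necessarily spacelike, and projecting `t`
  -- off `x` only lowers its square.
  have key : ∀ (n : ℕ) (U : Submodule ℝ V), Module.finrank ℝ U = n → (∀ v ∈ U, A v ∈ U) →
      ∀ t ∈ U, ¬ g t t < 0 := by
    intro n
    induction n with
    | zero =>
      intro U hU _ t ht htt
      rw [Submodule.finrank_eq_zero.1 hU, Submodule.mem_bot] at ht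
      simp [ht] at htt
    | succ n ih =>
      intro U hU hinv t ht htt
      have : Nontrivial U := Module.nontrivial_of_finrank_pos (R := ℝ) (by omega)
      obtain ⟨⟨x, hxU⟩, hx⟩ | ⟨v, hv, μ, ν, hν, h⟩ :=
        exists_isEigenvector_or_hasRotationPlane (A.restrict hinv)
      · obtain ⟨hx0, μ, hμ⟩ := isEigenvector_iff.1 hx
        have hμ' : A x = μ • x := congrArg Subtype.val hμ
        have hx0' : x ≠ 0 := fun h => hx0 (Subtype.ext h)
        have hxe : IsEigenvector A x := isEigenvector_iff.2 ⟨hx0', μ, hμ'⟩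
        have hxx : 0 < g x x := by
          rcases lt_trichotomy (g x x) 0 with h | h | h
          · exact absurd hxe (hno1 x h)
          · exact absurd hxe (hno2 x ⟨hx0', h⟩)
          · exact h
        have hfin := finrank_inf_ker_add_one (f := g x) hxU hxx.ne'
        have htx : g t x = g x t := hg.symm.eq t x
        refine ih (U ⊓ LinearMap.ker (g x)) (by omega) (inf_ker_invariant hA hinv hμ')
          (t - (g x t / g x x) • x) ⟨U.sub_mem ht (U.smul_mem _ hxU), ?_⟩ ?_
        · simp [hxx.ne']
        · have h1 : g (t - (g x t / g x x) • x) (t - (g x t / g x x) • x)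
              = g t t - g x t ^ 2 / g x x := by
            simp only [map_sub, map_smul, LinearMap.sub_apply, LinearMap.smul_apply, smul_eq_mul,
              htx]
            field_simp
            ring
          have h2 : 0 ≤ g x t ^ 2 / g x x := by positivity
          linarith
      · exact hno3 ⟨v, fun h0 => hv (Subtype.ext h0), μ, ν, hν, congrArg Subtype.val h⟩
  obtain ⟨b, hb⟩ := hg.exists_pentad
  exact key _ ⊤ rfl (fun _ _ => trivial) (b 0) trivial (by rw [hb.apply_zero]; norm_num)

/-- An invariant subspace of dimension at least three of `k^⊥`, where `k` is a null eigenvector,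
contains a spacelike eigenvector. -/
theorem exists_spacelike_eigenvector (hg : IsLorentz g) [FiniteDimensional ℝ V]
    (hA : ∀ v w, g (A v) w = g v (A w)) {k : V} (hk : IsNullVec g k) (hke : IsEigenvector A k)
    {U : Submodule ℝ V} (hkU : k ∈ U) (hUk : ∀ v ∈ U, g k v = 0) (hU : ∀ v ∈ U, A v ∈ U)
    (hdim : 3 ≤ Module.finrank ℝ U) : ∃ x ∈ U, 0 < g x x ∧ IsEigenvector A x := by
  obtain ⟨-, l, hl⟩ := isEigenvector_iff.1 hke
  obtain ⟨m, hm⟩ := hg.exists_apply_ne_zero hk.1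
  have hmk : g m k ≠ 0 := by rwa [hg.symm.eq]
  -- `S` is a complement of the line of `k` in `U`, a positive definite model of `U/k`.
  set S : Submodule ℝ V := U ⊓ LinearMap.ker (g m)
  have hSdim : Module.finrank ℝ S + 1 = Module.finrank ℝ U :=
    finrank_inf_ker_add_one (f := g m) hkU hmk
  have hpos : ∀ s ∈ S, s ≠ 0 → 0 < g s s := by
    rintro s ⟨hsU, hms⟩ hs0
    obtain ⟨α, rfl⟩ | h := hg.pos_of_orthogonal_null hk (hUk s hsU)
    · have : α = 0 := by simpa [hmk] using hms
      simp [this] at hs0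
    · exact h
  obtain ⟨b, hb, hd⟩ := exists_basis_orthonormal_diagonal rfl (g.restrict S)
    ((g.comp A LinearMap.id).restrict S) ⟨fun v w => hg.symm.eq v w⟩
    (fun v hv => hpos v v.2 (by simpa using hv))
    ⟨fun v w => by simp [hA (v : V) w, hg.symm.eq (v : V) (A w)]⟩
  simp only [BilinForm.restrict_apply, LinearMap.domRestrict_apply, BilinForm.comp_apply,
    LinearMap.id_apply] at hb hd
  have hkb : ∀ i, g k (b i) = 0 := fun i => hUk _ (b i).2.1
  have hbk : ∀ i, g (b i) k = 0 := fun i => by rw [hg.symm.eq, hkb]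
  -- The basis `b` diagonalizes the map induced on `U/k`, so `A (b i)` is right up to a multiple of
  -- `k`.
  have hform : ∀ i, ∃ μ c : ℝ, A (b i) = μ • (b i : V) + c • k := by
    intro i
    set y := A (b i) - g (A (b i)) (b i) • (b i : V) with hy
    have hyU : y ∈ U := U.sub_mem (hU _ (b i).2.1) (U.smul_mem _ (b i).2.1)
    set u : S := ⟨y - (g m y / g m k) • k, U.sub_mem hyU (U.smul_mem _ hkU), by simp [hmk]⟩
      with hu
    have h2 : g u ∘ₗ S.subtype = 0 := by
      refine b.ext fun j => ?_
      rcases eq_or_ne i j with rfl | hij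
      · simp [hu, hy, hb, hkb]
      · simp [hu, hy, hb, hij, hd i j hij, hkb]
    have h3 : (u : V) = 0 := by
      by_contra h0
      exact (hpos u u.2 h0).ne' (LinearMap.congr_fun h2 u)
    refine ⟨g (A (b i)) (b i), g m y / g m k, ?_⟩
    have h4 : y = (g m y / g m k) • k := sub_eq_zero.1 h3
    rw [← h4, hy]
    abel
  have hgood : ∀ i (μ c : ℝ), A (b i) = μ • (b i : V) + c • k → μ ≠ l →
      ∃ x ∈ U, 0 < g x x ∧ IsEigenvector A x := by
    intro i μ c h hμ
    -- When `μ ≠ l`, a shift of `b i` along `k` absorbs the error term without changing its square.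
    have hsub : μ - l ≠ 0 := sub_ne_zero.2 hμ
    have hx : 0 < g ((b i : V) + (c / (μ - l)) • k) ((b i : V) + (c / (μ - l)) • k) := by
      simp [hb, hkb, hbk, hk.2]
    refine ⟨_, U.add_mem (b i).2.1 (U.smul_mem _ hkU), hx,
      isEigenvector_of_apply_self_ne_zero hx.ne' (μ := μ) ?_⟩
    rw [map_add, map_smul, h, hl]
    have hc : c = c / (μ - l) * (μ - l) := by field_simp
    generalize c / (μ - l) = d at hc
    rw [hc]
    module
  let i₀ : Fin (Module.finrank ℝ S) := ⟨0, by omega⟩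
  let i₁ : Fin (Module.finrank ℝ S) := ⟨1, by omega⟩
  have hi : i₀ ≠ i₁ := by simp [i₀, i₁]
  obtain ⟨μ₀, c₀, h₀⟩ := hform i₀
  obtain ⟨μ₁, c₁, h₁⟩ := hform i₁
  by_cases e₀ : μ₀ = l
  swap
  · exact hgood _ _ _ h₀ e₀
  by_cases e₁ : μ₁ = l
  swap
  · exact hgood _ _ _ h₁ e₁
  subst e₀
  subst e₁
  -- Both eigenvalues now equal `l`, so no shift helps; instead `c₁ • b i₀ - c₀ • b i₁` cancels the
  -- two `k` terms. This is where dimension 3 is needed.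
  by_cases hc : c₀ = 0
  · have hx : 0 < g (b i₀) (b i₀) := by simp [hb]
    exact ⟨_, (b i₀).2.1, hx, isEigenvector_of_apply_self_ne_zero hx.ne' (by simpa [hc] using h₀)⟩
  · have hx : 0 < g (c₁ • (b i₀ : V) - c₀ • (b i₁ : V)) (c₁ • (b i₀ : V) - c₀ • (b i₁ : V)) := by
      have h1 : g (c₁ • (b i₀ : V) - c₀ • (b i₁ : V)) (c₁ • (b i₀ : V) - c₀ • (b i₁ : V))
          = c₁ ^ 2 + c₀ ^ 2 := by
        simp [hb, hi, hi.symm]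
        ring
      rw [h1]
      positivity
    refine ⟨_, U.sub_mem (U.smul_mem _ (b i₀).2.1) (U.smul_mem _ (b i₁).2.1), hx,
      isEigenvector_of_apply_self_ne_zero hx.ne' (μ := μ₁) ?_⟩
    rw [map_sub, map_smul, map_smul, h₀, h₁]
    module

/-- A null eigenvector `k` is orthogonal to two orthogonal spacelike eigenvectors, and these cut
out a chain of invariant subspaces of `k^⊥` of dimensions 4, 3 and 2. -/
theorem exists_spacelike_eigenvectors_of_null (hg : IsLorentz g) [FiniteDimensional ℝ V]
    (hA : ∀ v w, g (A v) w = g v (A w)) {k : V} (hk : IsNullVec g k) (hke : IsEigenvector A k) :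
    (∃ x y : V, (0 < g x x ∧ IsEigenvector A x) ∧ (0 < g y y ∧ IsEigenvector A y) ∧
      g x y = 0 ∧ g k x = 0 ∧ g k y = 0) ∧
    ∀ n : ℕ, 2 ≤ n ∧ n ≤ 4 → ∃ N : Submodule ℝ V, k ∈ N ∧ N ≤ LinearMap.ker (g k) ∧
      Module.finrank ℝ N = n ∧ ∀ v ∈ N, A v ∈ N := by
  obtain ⟨-, l, hl⟩ := isEigenvector_iff.1 hke
  have hU := inf_ker_invariant hA (U := ⊤) (fun _ _ => trivial) hl
  rw [top_inf_eq] at hU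
  have hUdim := hg.finrank_ker hk.1
  obtain ⟨x, hxU, hxx, hxe⟩ := exists_spacelike_eigenvector hg hA hk hke hk.2 (fun _ h => h) hU
    (by omega)
  obtain ⟨-, μ, hμ⟩ := isEigenvector_iff.1 hxe
  have hU' := inf_ker_invariant hA hU hμ
  have hUdim' := finrank_inf_ker_add_one (f := g x) hxU hxx.ne'
  have hkx : g k x = 0 := hxU
  have hkU' : k ∈ LinearMap.ker (g k) ⊓ LinearMap.ker (g x) :=
    ⟨hk.2, by rw [SetLike.mem_coe, LinearMap.mem_ker, hg.symm.eq, hkx]⟩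
  obtain ⟨y, hyU, hyy, hye⟩ := exists_spacelike_eigenvector hg hA hk hke hkU' (fun _ h => h.1) hU'
    (by omega)
  obtain ⟨-, ν, hν⟩ := isEigenvector_iff.1 hye
  have hUdim'' := finrank_inf_ker_add_one (f := g y) hyU hyy.ne'
  have hky : g k y = 0 := hyU.1
  refine ⟨⟨x, y, ⟨hxx, hxe⟩, ⟨hyy, hye⟩, hyU.2, hkx, hky⟩, ?_⟩
  rintro n ⟨hn2, hn4⟩
  interval_cases n
  · exact ⟨LinearMap.ker (g k) ⊓ LinearMap.ker (g x) ⊓ LinearMap.ker (g y),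
      ⟨hkU', by rw [SetLike.mem_coe, LinearMap.mem_ker, hg.symm.eq, hky]⟩,
      inf_le_left.trans inf_le_left, by omega, inf_ker_invariant hA hU' hν⟩
  · exact ⟨_, hkU', inf_le_left, by omega, hU'⟩
  · exact ⟨_, hk.2, le_rfl, hUdim, hU⟩

/-- A self-adjoint map has three orthogonal independent eigenvectors, two of them spacelike. -/
theorem exists_three_orthogonal_eigenvectors (hg : IsLorentz g) [FiniteDimensional ℝ V]
    (hA : ∀ v w, g (A v) w = g v (A w)) :
    ∃ e : Fin 3 → V, LinearIndependent ℝ e ∧ (∀ i j, i ≠ j → g (e i) (e j) = 0) ∧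
      (∀ i, IsEigenvector A (e i)) ∧ IsSpacelikeVec g (e 0) ∧ IsSpacelikeVec g (e 1) := by
  have hpos : ∀ e : Fin 3 → V, (∀ i j, g (e i) (e j) = if i = j then 1 else 0) →
      (∀ i, IsEigenvector A (e i)) →
      ∃ e : Fin 3 → V, LinearIndependent ℝ e ∧ (∀ i j, i ≠ j → g (e i) (e j) = 0) ∧
      (∀ i, IsEigenvector A (e i)) ∧ IsSpacelikeVec g (e 0) ∧ IsSpacelikeVec g (e 1) := by
    intro e heo hev
    have ho : ∀ i j, i ≠ j → g (e i) (e j) = 0 := fun i j hij => by rw [heo, if_neg hij]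
    refine ⟨e, BilinForm.linearIndependent_of_iIsOrtho (B := g) (fun i j hij => ho i j hij) ?_,
      ho, hev, by simp [IsSpacelikeVec, heo], by simp [IsSpacelikeVec, heo]⟩
    intro i (h : g (e i) (e i) = 0)
    simp [heo] at h
  obtain ⟨t, htt, ht⟩ | ⟨k, hk, hke⟩ | h :=
    exists_timelike_or_null_eigenvector_or_hasRotationPlane hg hA
  · obtain ⟨b, hb, hbe⟩ := exists_pentad_of_timelike_eigenvector hg hA htt ht
    -- The legs 1, 2, 3 of the pentad, which skip the timelike leg 0.
    refine hpos (fun i => b (Fin.succ (Fin.castSucc i))) (fun i j => ?_) fun i => hbe _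
    simp [hb _ _]
  · obtain ⟨⟨x, y, ⟨hxx, hxe⟩, ⟨hyy, hye⟩, hxy, hkx, hky⟩, -⟩ :=
      exists_spacelike_eigenvectors_of_null hg hA hk hke
    have hyx : g y x = 0 := by rw [hg.symm.eq, hxy]
    have hxk : g x k = 0 := by rw [hg.symm.eq, hkx]
    have hyk : g y k = 0 := by rw [hg.symm.eq, hky]
    refine ⟨![x, y, k], ?_, ?_, ?_, hxx, hyy⟩
    · rw [Fintype.linearIndependent_iff]
      intro c hc
      simp only [Fin.sum_univ_three, Matrix.cons_val] at hc
      have h0 : c 0 = 0 := by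
        have := congrArg (g x) hc
        simpa [hxy, hxk, hxx.ne'] using this
      have h1 : c 1 = 0 := by
        have := congrArg (g y) hc
        simpa [hyx, hyk, hyy.ne'] using this
      have h2 : c 2 = 0 := by simpa [h0, h1, hk.1] using hc
      intro i
      fin_cases i <;> assumption
    · intro i j hij
      fin_cases i <;> fin_cases j <;> first | exact absurd rfl hij | assumption
    · intro i
      fin_cases i <;> assumption
  · obtain ⟨S, hS3, hSA, hSpos, -⟩ := h.exists_invariant hg hA
    obtain ⟨e, -, heo, hev⟩ := exists_orthonormal_eigenvectors hg.symm hA hSA hSpos rfl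
    refine hpos (fun i => e (Fin.castLE hS3 i)) (fun i j => ?_) fun i => hev _
    simp [heo]

/-- An orthogonal pair of spacelike eigenvectors spans an invariant spacelike plane, whose
orthogonal complement is an invariant timelike 3-space. -/
theorem exists_spacelike_plane_and_timelike_complement (hg : IsLorentz g) [FiniteDimensional ℝ V]
    (hA : ∀ v w, g (A v) w = g v (A w)) {x y : V} (hxx : 0 < g x x) (hyy : 0 < g y y)
    (hxy : g x y = 0) (hx : IsEigenvector A x) (hy : IsEigenvector A y) :
    (∃ W : Submodule ℝ V, Module.finrank ℝ W = 2 ∧ IsSpacelikeSubspace g W ∧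
      ∀ v ∈ W, A v ∈ W) ∧
    ∃ W : Submodule ℝ V, Module.finrank ℝ W = 3 ∧ IsTimelikeSubspace g W ∧
      ∀ v ∈ W, A v ∈ W := by
  have hyx : g y x = 0 := by rw [hg.symm.eq, hxy]
  obtain ⟨hx0, μ, hμ⟩ := isEigenvector_iff.1 hx
  obtain ⟨hy0, ν, hν⟩ := isEigenvector_iff.1 hy
  constructor
  · refine ⟨Submodule.span ℝ {x, y}, ?_, ?_, ?_⟩
    · have hli : LinearIndependent ℝ ![x, y] := by
        rw [LinearIndependent.pair_iff]
        intro a c h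
        have h1 := congrArg (g x) h
        have h2 := congrArg (g y) h
        simp only [map_add, map_smul, hxy, hyx, smul_eq_mul, mul_zero, zero_add, add_zero,
          map_zero, mul_eq_zero, hxx.ne', hyy.ne', or_false] at h1 h2
        exact ⟨h1, h2⟩
      have := finrank_span_eq_card hli
      rwa [Matrix.range_cons_cons_empty, Fintype.card_fin] at this
    · intro v hv hv0
      obtain ⟨a, c, rfl⟩ := Submodule.mem_span_pair.1 hv
      have h1 : g (a • x + c • y) (a • x + c • y) = a ^ 2 * g x x + c ^ 2 * g y y := by
        simp only [map_add, map_smul, LinearMap.add_apply, LinearMap.smul_apply, hxy, hyx,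
          smul_eq_mul]
        ring
      rw [IsSpacelikeVec, h1]
      rcases eq_or_ne a 0 with rfl | ha
      · rcases eq_or_ne c 0 with rfl | hc
        · simp at hv0
        · positivity
      · positivity
    · intro v hv
      obtain ⟨a, c, rfl⟩ := Submodule.mem_span_pair.1 hv
      rw [map_add, map_smul, map_smul, hμ, hν]
      exact Submodule.mem_span_pair.2 ⟨a * μ, c * ν, by simp [mul_smul]⟩
  · have hU := inf_ker_invariant hA (U := ⊤) (fun _ _ => trivial) hμ
    rw [top_inf_eq] at hU
    have hdim := finrank_inf_ker_add_one (U := LinearMap.ker (g x)) (f := g y) (u := y) hxy hyy.ne'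
    rw [hg.finrank_ker hx0] at hdim
    refine ⟨LinearMap.ker (g x) ⊓ LinearMap.ker (g y), by omega, ?_, inf_ker_invariant hA hU hν⟩
    obtain ⟨b, hb⟩ := hg.exists_pentad
    have hbb := hb.apply_zero
    set t := b 0
    have htx : g t x = g x t := hg.symm.eq t x
    have hty : g t y = g y t := hg.symm.eq t y
    -- The timelike leg `t` projected off `x` and `y`; both corrections only lower its square below
    -- `-1`.
    refine isTimelikeSubspace_of_mem hg (by omega)
      (t := t - (g x t / g x x) • x - (g y t / g y y) • y) ⟨?_, ?_⟩ ?_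
    · simp [hxy, hxx.ne']
    · simp [hyx, hyy.ne']
    · have h1 : g (t - (g x t / g x x) • x - (g y t / g y y) • y)
          (t - (g x t / g x x) • x - (g y t / g y y) • y)
          = -1 - g x t ^ 2 / g x x - g y t ^ 2 / g y y := by
        simp only [map_sub, map_smul, LinearMap.sub_apply, LinearMap.smul_apply, smul_eq_mul,
          htx, hty, hxy, hyx, hbb]
        field_simp
        ring
      have h2 : 0 ≤ g x t ^ 2 / g x x := by positivity
      have h3 : 0 ≤ g y t ^ 2 / g y y := by positivity
      linarith

end SelfAdjoint

/-! ### Canonical form, null eigendirections and null invariant subspaces. -/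

section Tensor

variable {V : Type*} [AddCommGroup V] [Module ℝ V] {g : BilinForm ℝ V} {A : Module.End ℝ V}

theorem toEnd_selfAdjoint [FiniteDimensional ℝ V] (hg : IsLorentz g) {T : BilinForm ℝ V}
    (hT : T.IsSymm) (v w : V) : g (toEnd hg T v) w = g v (toEnd hg T w) := by
  rw [hg.symm.eq v, apply_toEnd, apply_toEnd, hT.eq]

theorem isType1_1111_of_pentad [FiniteDimensional ℝ V] (hg : IsLorentz g) {T : BilinForm ℝ V}
    {b : Module.Basis (Fin 5) ℝ V} (hb : IsPentad g b) (he : ∀ i, IsEigenvector (toEnd hg T) (b i)) :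
    IsType1_1111 g T := by
  choose μ hμ using fun i => (isEigenvector_iff.1 (he i)).2
  -- Lowering the index flips the sign of the timelike coefficient, whence the factor `g (b i) (b
  -- i)`.
  refine ⟨b, hb, fun i => μ i * g (b i) (b i), ?_⟩
  have h : T = ∑ i, (μ i * g (b i) (b i)) • BilinForm.linMulLin (g (b i)) (g (b i)) := by
    refine LinearMap.BilinForm.ext_basis b fun i j => ?_
    rw [← apply_toEnd hg T, hμ]
    simp only [LinearMap.sum_apply, LinearMap.smul_apply, BilinForm.linMulLin_apply, map_smul]
    rw [Finset.sum_eq_single i]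
    · rcases eq_or_ne i j with rfl | hij
      · simp only [hb i i, smul_eq_mul]
        split_ifs <;> simp
      · simp [hb i j, hij]
    · intro l _ hl
      simp [hb l i, hl]
    · simp
  intro v w
  conv_lhs => rw [h]
  simp [LinearMap.sum_apply]

theorem IsType1_1111.isDiagonalizable [FiniteDimensional ℝ V] (hg : IsLorentz g)
    {T : BilinForm ℝ V} (h : IsType1_1111 g T) : IsDiagonalizable (toEnd hg T) := by
  obtain ⟨b, hb, c, hc⟩ := h
  refine ⟨b, fun j => isEigenvector_iff.2 ⟨b.ne_zero j, c j * g (b j) (b j), ?_⟩⟩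
  rw [← sub_eq_zero]
  refine hg.nondegenerate.1 _ fun w => ?_
  rw [map_sub, LinearMap.sub_apply, apply_toEnd, hc, Finset.sum_eq_single j]
  · simp
    ring
  · intro l _ hl
    simp [hb l j, hl]
  · simp

theorem timelike_eigenvector_iff_isDiagonalizable [FiniteDimensional ℝ V] (hg : IsLorentz g)
    (hA : ∀ v w, g (A v) w = g v (A w)) :
    (∃ v, IsTimelikeVec g v ∧ IsEigenvector A v) ↔ IsDiagonalizable A := by
  refine ⟨?_, exists_timelike_eigenvector_of_isDiagonalizable hg hA⟩
  rintro ⟨t, htt, ht⟩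
  obtain ⟨b, -, hb⟩ := exists_pentad_of_timelike_eigenvector hg hA htt ht
  exact ⟨b, hb⟩

theorem isDiagonalizable_iff_isType1_1111 [FiniteDimensional ℝ V] (hg : IsLorentz g)
    {T : BilinForm ℝ V} (hT : T.IsSymm) :
    IsDiagonalizable (toEnd hg T) ↔ IsType1_1111 g T := by
  refine ⟨fun h => ?_, fun h => h.isDiagonalizable hg⟩
  have hA := toEnd_selfAdjoint hg hT
  obtain ⟨t, htt, ht⟩ := exists_timelike_eigenvector_of_isDiagonalizable hg hA h
  obtain ⟨b, hb, hbe⟩ := exists_pentad_of_timelike_eigenvector hg hA htt ht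
  exact isType1_1111_of_pentad hg hb hbe

/-- Real eigenvalues exclude a rotation plane and non-diagonalizability a timelike eigenvector, so
the trichotomy leaves a null one; a second null eigendirection would produce a timelike eigenvector.
Conversely, a null eigenvector excludes a rotation plane and its uniqueness a timelike eigenvector.
-/
theorem real_not_diagonalizable_iff [FiniteDimensional ℝ V] (hg : IsLorentz g)
    (hA : ∀ v w, g (A v) w = g v (A w)) :
    (AllEigenvaluesReal A ∧ ¬ IsDiagonalizable A) ↔
      ∃! L : Submodule ℝ V, L ∈ nullEigendirections g A := by
  rw [← timelike_eigenvector_iff_isDiagonalizable hg hA]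
  constructor
  · rintro ⟨hreal, hno⟩
    obtain h | ⟨k, hk, hke⟩ | h := exists_timelike_or_null_eigenvector_or_hasRotationPlane hg hA
    · exact absurd h hno
    · refine ⟨Submodule.span ℝ {k}, ⟨k, hk, hke, rfl⟩, ?_⟩
      rintro _ ⟨l, hl, hle, rfl⟩
      by_contra hne
      refine hno (exists_timelike_eigenvector_of_null_null hg hA hk hl ?_ hke hle)
      rintro α rfl
      have hα : α ≠ 0 := by rintro rfl; simp [IsNullVec] at hl
      exact hne (Submodule.span_singleton_smul_eq (IsUnit.mk0 α hα) k)
    · exact absurd h (not_hasRotationPlane_of_allEigenvaluesReal hreal)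
  · intro h
    refine ⟨?_, ?_⟩
    · by_contra hreal
      obtain ⟨L, ⟨k, hk, hke, -⟩, -⟩ := h
      exact (hasRotationPlane_of_not_allEigenvaluesReal hreal).not_null_eigenvector hg hA hk hke
    · rintro ⟨t, htt, ht⟩
      exact not_existsUnique_nullEigendirection hg hA htt ht h

theorem orthogonal_mem_invtSubmodule (hA : ∀ v w, g (A v) w = g v (A w)) {W : Submodule ℝ V}
    (hW : W ∈ A.invtSubmodule) : g.orthogonal W ∈ A.invtSubmodule := by
  rw [Module.End.mem_invtSubmodule_iff_forall_mem_of_mem] at hW ⊢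
  intro v hv
  rw [BilinForm.mem_orthogonal_iff] at hv ⊢
  intro w hw
  change g w (A v) = 0
  rw [← hA]
  exact hv _ (hW w hw)

/-- The null vector `k` of `N` is orthogonal to `N`, which contains `A k` and `A (A k)`. So `A k` is
orthogonal to `k` with square `g k (A (A k)) = 0`, hence a multiple of `k`. -/
theorem IsNullInvariant.exists_null_eigenvector (hg : IsLorentz g)
    (hA : ∀ v w, g (A v) w = g v (A w)) {n : ℕ} {N : Submodule ℝ V} (hN : IsNullInvariant g A n N) :
    ∃ k ∈ N, IsNullVec g k ∧ IsEigenvector A k := by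
  obtain ⟨hnull, -, hinv⟩ := hN
  rw [Module.End.mem_invtSubmodule_iff_forall_mem_of_mem] at hinv
  obtain ⟨k, hkN, hk, hko⟩ := hnull.exists_null hg
  refine ⟨k, hkN, hk, isEigenvector_iff.2 ⟨hk.1, ?_⟩⟩
  obtain h | h := hg.pos_of_orthogonal_null hk (hko _ (hinv k hkN))
  · exact h
  · rw [hA, hko _ (hinv _ (hinv k hkN))] at h
    exact absurd h (lt_irrefl 0)

theorem exists_isNullInvariant [FiniteDimensional ℝ V] (hg : IsLorentz g)
    (hA : ∀ v w, g (A v) w = g v (A w)) {k : V} (hk : IsNullVec g k) (hke : IsEigenvector A k)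
    {n : ℕ} (hn : 2 ≤ n ∧ n ≤ 4) : ∃ N, IsNullInvariant g A n N := by
  obtain ⟨N, hkN, hNk, hdim, hinv⟩ :=
    (exists_spacelike_eigenvectors_of_null hg hA hk hke).2 n hn
  exact ⟨N, isNullSubspace_of_le_ker hg hk hkN hNk, hdim,
    (Module.End.mem_invtSubmodule_iff_forall_mem_of_mem _).2 hinv⟩

end Tensor

end Lorentz5

open Lorentz5 in
theorem mainTheorem3 {V : Type*} [AddCommGroup V] [Module ℝ V] [FiniteDimensional ℝ V]
    (hdim : Module.finrank ℝ V = 5)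
    (g : LinearMap.BilinForm ℝ V) (hg : IsLorentz g)
    (T : LinearMap.BilinForm ℝ V) (hT : T.IsSymm) :
    -- 1. timelike eigenvector iff diagonalizable over the reals, iff of type {1,1111}
    (((∃ v, IsTimelikeVec g v ∧ IsEigenvector (toEnd hg T) v) ↔ IsDiagonalizable (toEnd hg T)) ∧
      (IsDiagonalizable (toEnd hg T) ↔ IsType1_1111 g T)) ∧
    -- 2. three independent, mutually orthogonal real eigenvectors, two of them spacelike
    (∃ e : Fin 3 → V, LinearIndependent ℝ e ∧ (∀ i j, i ≠ j → g (e i) (e j) = 0) ∧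
      (∀ i, IsEigenvector (toEnd hg T) (e i)) ∧
      IsSpacelikeVec g (e 0) ∧ IsSpacelikeVec g (e 1)) ∧
    -- 3. real eigenvalues but not diagonalizable iff there is a unique null eigendirection
    ((AllEigenvaluesReal (toEnd hg T) ∧ ¬ IsDiagonalizable (toEnd hg T)) ↔
      ∃! L : Submodule ℝ V, L ∈ nullEigendirections g (toEnd hg T)) ∧
    -- 4. two independent null eigenvectors
    ((∃ k l : V, LinearIndependent ℝ ![k, l] ∧
        (IsNullVec g k ∧ IsEigenvector (toEnd hg T) k) ∧
        (IsNullVec g l ∧ IsEigenvector (toEnd hg T) l)) →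
      IsDiagonalizable (toEnd hg T) ∧ IsType1_1111 g T) ∧
    -- 5. an invariant spacelike 2-space
    (∃ W : Submodule ℝ V, Module.finrank ℝ W = 2 ∧ IsSpacelikeSubspace g W ∧
      W ∈ (toEnd hg T).invtSubmodule) ∧
    -- 6. orthogonal complements of non-null invariant subspaces
    (∀ W : Submodule ℝ V, ¬ IsNullSubspace g W → W ∈ (toEnd hg T).invtSubmodule →
      g.orthogonal W ∈ (toEnd hg T).invtSubmodule) ∧
    -- 7. an invariant timelike 3-space
    (∃ W : Submodule ℝ V, Module.finrank ℝ W = 3 ∧ IsTimelikeSubspace g W ∧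
      W ∈ (toEnd hg T).invtSubmodule) ∧
    -- 8. null invariant subspaces and null eigenvectors
    (((∃ n : ℕ, (2 ≤ n ∧ n ≤ 4) ∧ ∃ N, IsNullInvariant g (toEnd hg T) n N) ↔
        ∀ n : ℕ, 2 ≤ n ∧ n ≤ 4 → ∃ N, IsNullInvariant g (toEnd hg T) n N) ∧
      ((∃ n : ℕ, (2 ≤ n ∧ n ≤ 4) ∧ ∃ N, IsNullInvariant g (toEnd hg T) n N) ↔
        ∃ k, IsNullVec g k ∧ IsEigenvector (toEnd hg T) k) ∧
      ∀ (n : ℕ) (N : Submodule ℝ V), 2 ≤ n ∧ n ≤ 4 → IsNullInvariant g (toEnd hg T) n N →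
        ∃ k ∈ N, IsNullVec g k ∧ IsEigenvector (toEnd hg T) k) := by
  have hA := toEnd_selfAdjoint hg hT
  have h1 := timelike_eigenvector_iff_isDiagonalizable hg hA
  have h2 := isDiagonalizable_iff_isType1_1111 hg hT
  have h3 := exists_three_orthogonal_eigenvectors hg hA
  -- The right-hand side does not involve `n`, so the three dimensions stand or fall together.
  have hnull : ∀ (n : ℕ), 2 ≤ n ∧ n ≤ 4 → ((∃ N, IsNullInvariant g (toEnd hg T) n N) ↔
      ∃ k, IsNullVec g k ∧ IsEigenvector (toEnd hg T) k) := by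
    refine fun n hn => ⟨?_, fun ⟨k, hk, hke⟩ => exists_isNullInvariant hg hA hk hke hn⟩
    rintro ⟨N, hN⟩
    obtain ⟨k, -, hk⟩ := hN.exists_null_eigenvector hg hA
    exact ⟨k, hk⟩
  have ⟨e, _, heo, hev, he0, he1⟩ := h3
  have ⟨hplane, htime⟩ := exists_spacelike_plane_and_timelike_complement hg hA he0 he1
    (heo 0 1 (by decide)) (hev 0) (hev 1)
  refine ⟨⟨h1, h2⟩, h3, real_not_diagonalizable_iff hg hA, ?_, ?_,
    fun W _ hW => orthogonal_mem_invtSubmodule hA hW, ?_, ?_, ?_, ?_⟩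
  · rintro ⟨k, l, hli, ⟨hk, hke⟩, ⟨hl, hle⟩⟩
    have hd := h1.1 (exists_timelike_eigenvector_of_null_null hg hA hk hl
      (fun α hα => (LinearIndependent.pair_iff' hk.1).1 hli α hα.symm) hke hle)
    exact ⟨hd, h2.1 hd⟩
  · simpa only [Module.End.mem_invtSubmodule_iff_forall_mem_of_mem] using hplane
  · simpa only [Module.End.mem_invtSubmodule_iff_forall_mem_of_mem] using htime
  · refine ⟨fun ⟨n, hn, h⟩ m hm => (hnull m hm).2 ((hnull n hn).1 h), fun h => ⟨2, ?_, h 2 ?_⟩⟩ <;>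
    norm_num
  · refine ⟨fun ⟨n, hn, h⟩ => (hnull n hn).1 h, fun h => ⟨2, ?_, (hnull 2 ?_).2 h⟩⟩ <;> norm_num
  · exact fun n N _ hN => hN.exists_null_eigenvector hg hA
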